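/- Let $k$ be a field, $t\ge 0$ an integer and $0=m_0\le m_1\le\dots\le m_t$ integers, so that $E=(x^t,x^{t-1}y^{m_1},\dots,xy^{m_{t-1}},y^{m_t})\subset k[x,y]$ is a monomial ideal of finite colength (every such ideal has this form). Put $d_i=m_i-m_{i-1}$ for $1\le i\le t$. Let $k[\mathbf a]$ be the polynomial ring in variables $a_{i,j,l}$, where $1\le i\le t+1$, $1\le j\le t$, and $0\le l<d_j$ if $i>j$, $0\le l<d_i$ if $i\le j$. Let $B=\operatorname{Spec} k[\mathbf a]$ and $a_{i,j}=\sum_l a_{i,j,l}\,y^l$. Let $\mathcal M$ be the $(t+1)\times t$ matrix over $k[\mathbf a][x,y]$ whose $(i,j)$ entry is $a_{i,j}+y^{d_j}$ if $i=j$, $a_{i,j}-x$ if $i=j+1$, and $a_{i,j}$ otherwise. Let $I_t(\mathcal M)$ be the ideal generated by its maximal minors and let $$\pi\colon V(I_t(\mathcal M))\hookrightarrow \mathbb A^2\times B\longrightarrow B$$ be the composition of the inclusion and the projection. Let $\mathrm{res}_E\in k[\mathbf a][y]$ be the resultant, with respect to $x$, of the determinants of $\mathcal M$ with the first row removed and with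 the last row removed. Let $B'\subset B$ be the open complement of the common vanishing locus of all coefficients of $\mathrm{res}_E$ as a polynomial in $y$. Let $S$ be the subscheme of $B$ on which $\mathrm{res}_E$ has degree exactly $t\,m_t$ in $y$, that is, the intersection of the closed subscheme defined by the coefficients of $y^n$ in $\mathrm{res}_E$ for all $n>t\,m_t$ with the open subscheme on which the coefficient of $y^{t m_t}$ is invertible. Then $S$ is a locally closed subscheme of $B'$, and the restriction $V(I_t(\mathcal M))\times_B S\to S$ of $\pi$ to $S$ is finite and flat. -/

import Mathlib

open AlgebraicGeometry CategoryTheory CategoryTheory.Limits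

-- Instance search on `Polynomial (Polynomial (MvPolynomial σ k))` needs a larger nesting depth.
set_option maxSynthPendingDepth 5

universe u

noncomputable section

namespace HilbertBurch

/-! A monomial ideal of finite colength is given by the exponents `0 = m 0 ≤ m 1 ≤ ... ≤ m t` in
`E = (x ^ t, x ^ (t - 1) * y ^ (m 1), ..., x * y ^ (m (t - 1)), y ^ (m t))`. Rows of the matrices
below are indexed by `Fin (t + 1)` and columns by `Fin t`, so indices start at `0`. -/

/-- The steps `d_j = m_j - m_{j-1}` (`j = 1, ..., t`), indexed from `0`. -/
def step {t : ℕ} (m : Fin (t + 1) → ℕ) (j : Fin t) : ℕ :=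
  m j.succ - m j.castSucc

/-- The strict bound on the `y`-degree of the entry `a_{i,j}`: it is `d_j` if `i > j` and `d_i` if
`i ≤ j`. -/
def bound {t : ℕ} (m : Fin (t + 1) → ℕ) (i : Fin (t + 1)) (j : Fin t) : ℕ :=
  if h : j.castSucc < i then step m j
  else step m (i.castLT (lt_of_le_of_lt (Fin.le_def.mp (not_lt.mp h)) j.isLt))

/-- The index set of the parameters `a_{i,j,l}`: triples with `l < bound m i j`. -/
abbrev Param {t : ℕ} (m : Fin (t + 1) → ℕ) : Type :=
  Σ i : Fin (t + 1), Σ j : Fin t, Fin (bound m i j)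

variable (k : Type u) [Field k] {t : ℕ} (m : Fin (t + 1) → ℕ)

/-- The polynomial ring `k[a]` in all parameters `a_{i,j,l}`. -/
abbrev ParamRing : Type u := MvPolynomial (Param m) k

/-- The ring `k[a][y][x]`: the outer variable is `x`, the inner one is `y`. -/
abbrev TotalRing : Type u := Polynomial (Polynomial (ParamRing k m))

/-- The variable `x`. -/
def xVar : TotalRing k m := Polynomial.X

/-- The variable `y`. -/
def yVar : TotalRing k m := Polynomial.C Polynomial.X

/-- The universal entry `a_{i,j} = ∑ l, a_{i,j,l} * y ^ l`, with `l < bound m i j`. -/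
def entry (i : Fin (t + 1)) (j : Fin t) : TotalRing k m :=
  ∑ l : Fin (bound m i j),
    Polynomial.C (Polynomial.C (MvPolynomial.X (⟨i, j, l⟩ : Param m))) * yVar k m ^ (l : ℕ)

/-- The Hilbert-Burch matrix `M_E` of the monomial ideal `E`: it has `y ^ d_j` at `(j, j)`, `-x` at
`(j + 1, j)`, and zeros elsewhere. -/
def monomialMatrix : Matrix (Fin (t + 1)) (Fin t) (TotalRing k m) :=
  Matrix.of fun i j =>
    if i = j.castSucc then yVar k m ^ step m j else if i = j.succ then -xVar k m else 0

/-- The spread out matrix, `M_E + (a_{i,j})`. -/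
def spreadMatrix : Matrix (Fin (t + 1)) (Fin t) (TotalRing k m) :=
  monomialMatrix k m + Matrix.of (entry k m)

/-- The `i`-th maximal minor of the spread out matrix: the determinant without the `i`-th row. -/
def minor (i : Fin (t + 1)) : TotalRing k m :=
  ((spreadMatrix k m).submatrix i.succAbove id).det

/-- The ideal of maximal minors of the spread out matrix. -/
def minorIdeal : Ideal (TotalRing k m) :=
  Ideal.span (Set.range (minor k m))

/-- The base `B = Spec k[a]`. -/
abbrev base : Scheme.{u} := Spec (CommRingCat.of (ParamRing k m))

/-- The product `𝔸² × B = Spec k[a][y][x]`. -/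
abbrev plane : Scheme.{u} := Spec (CommRingCat.of (TotalRing k m))

/-- The projection `𝔸² × B ⟶ B`. -/
def planeToBase : plane k m ⟶ base k m :=
  Spec.map (CommRingCat.ofHom
    ((Polynomial.C : Polynomial (ParamRing k m) →+* TotalRing k m).comp Polynomial.C))

/-- The closed subscheme of `𝔸² × B` cut out by the maximal minors. -/
abbrev incidence : Scheme.{u} := Spec (CommRingCat.of (TotalRing k m ⧸ minorIdeal k m))

/-- The closed immersion of the incidence scheme into `𝔸² × B`. -/
def incidenceToPlane : incidence k m ⟶ plane k m :=
  Spec.map (CommRingCat.ofHom (Ideal.Quotient.mk (minorIdeal k m)))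

/-- The family `π`. -/
def family : incidence k m ⟶ base k m :=
  incidenceToPlane k m ≫ planeToBase k m

/-- The resultant with respect to `x` of the first and the last maximal minor, in `k[a][y]`. -/
def res : Polynomial (ParamRing k m) :=
  Polynomial.resultant (minor k m 0) (minor k m (Fin.last t))

/-- The open subscheme `B'` of `B`: the complement of the common vanishing locus of all coefficients
of the resultant as a polynomial in `y`. -/
def baseOpen : (base k m).Opens :=
  ⟨(PrimeSpectrum.zeroLocus (Set.range (res k m).coeff))ᶜ,
    (PrimeSpectrum.isClosed_zeroLocus _).isOpen_compl⟩

/-- The expected degree `t * m_t` of the resultant. -/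
def expectedDegree : ℕ := t * m (Fin.last t)

/-- The ideal generated by the coefficients of the resultant at `y ^ n` for `n > t * m_t`. -/
def higherCoeffIdeal : Ideal (ParamRing k m) :=
  Ideal.span {c | ∃ n, expectedDegree m < n ∧ c = (res k m).coeff n}

/-- The coordinate ring of `S`: the coefficients of the resultant in degrees above `t * m_t` are set
to zero, and the one in degree `t * m_t` is inverted. -/
abbrev StratumRing : Type u :=
  Localization.Away (Ideal.Quotient.mk (higherCoeffIdeal k m)
    ((res k m).coeff (expectedDegree m)))

/-- The subscheme `S` where the resultant has degree exactly `t * m_t` in `y`: the intersection of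
the closed subscheme where the higher coefficients vanish with the open subscheme where the
coefficient of `y ^ (t * m_t)` is invertible. -/
abbrev stratum : Scheme.{u} := Spec (CommRingCat.of (StratumRing k m))

/-- The inclusion `S ⟶ B`. -/
def stratumToBase : stratum k m ⟶ base k m :=
  Spec.map (CommRingCat.ofHom
    ((algebraMap (ParamRing k m ⧸ higherCoeffIdeal k m) (StratumRing k m)).comp
      (Ideal.Quotient.mk (higherCoeffIdeal k m))))

/-- The restriction of the family `π` to `S`. -/
def familyOnStratum : pullback (family k m) (stratumToBase k m) ⟶ stratum k m :=
  pullback.snd (family k m) (stratumToBase k m)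

end HilbertBurch

end

/-! Let `T` be the coordinate ring of `S` and `A = T[y]`. Up to sign, the minor without the first
row is the characteristic polynomial in `x` of a `t × t` matrix over `A`, so `F = A[x]/(charpoly)`
is free of rank `t` over `A`. Expanding determinants with a repeated column shows that the `A`-span
in `F` of the other `t` signed minors is stable under `x`. Hence the coordinate ring `Q` of the
family over `S` is the cokernel of an `A`-linear map `φ : A^t → F` (`mk_mem_range_minorsMap_iff`).

The resultant lies in the ideal of minors, and over `S` it is a unit times a monic `h` in `T[y]`. So
`Q` is finite over `T[y]/(h)`, hence over `T`. Moreover `hF ⊆ im φ` gives `ψ` with `φψ = h`. This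
forces `φ` to be injective, and `ψ` followed by division by `h`, which is only `T`-linear, is a
retraction of `φ`. Thus `Q` is a `T`-direct summand of the free `T`-module `F`, so it is projective
and flat (`projective_of_smul_mem_range`). -/

/-- If multiplication by `h` on a finite free `A`-module factors through a square matrix `φ`, and
multiplication by `h` on `A` has a `T`-linear retraction, then the cokernel of `φ` is projective
over `T`. -/
theorem projective_of_smul_mem_range {T A F Q ι : Type*} [CommRing T] [CommRing A] [Algebra T A]
    [AddCommGroup F] [Module A F] [Module T F] [IsScalarTower T A F]
    [AddCommGroup Q] [Module A Q] [Module T Q] [IsScalarTower T A Q]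
    [Fintype ι] [DecidableEq ι] [Module.Projective T F] (b : Module.Basis ι A F)
    (φ : (ι → A) →ₗ[A] F) (s : F →ₗ[A] Q) (hs : Function.Surjective s)
    (hφ : LinearMap.ker s = LinearMap.range φ) (h : A) (hh : h ∈ nonZeroDivisors A)
    (hr : ∀ x : F, h • x ∈ LinearMap.range φ) (δ : A →ₗ[T] A) (hδ : ∀ a, δ (h * a) = a) :
    Module.Projective T Q := by
  choose c hc using fun i => hr (b i)
  let ψ : F →ₗ[A] (ι → A) := b.constr A c
  have hψ : ∀ x, φ (ψ x) = h • x := by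
    intro x
    have : φ ∘ₗ ψ = h • LinearMap.id := b.ext fun i => by simp [ψ, hc]
    exact LinearMap.congr_fun this x
  let α : (ι → A) →ₗ[A] (ι → A) := b.equivFun.toLinearMap ∘ₗ φ
  let β : (ι → A) →ₗ[A] (ι → A) := ψ ∘ₗ b.equivFun.symm.toLinearMap
  have hαβ : α ∘ₗ β = h • LinearMap.id := by
    refine LinearMap.ext fun v => ?_
    simp only [α, β, LinearMap.comp_apply, LinearEquiv.coe_coe, hψ, map_smul,
      LinearEquiv.apply_symm_apply, LinearMap.smul_apply, LinearMap.id_apply]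
  -- This determinant divides a power of the non-zero-divisor `h`; that gives injectivity.
  have hdet : (LinearMap.toMatrix' α).det ∈ nonZeroDivisors A := by
    have h1 : (LinearMap.toMatrix' α).det * (LinearMap.toMatrix' β).det = h ^ Fintype.card ι := by
      rw [← Matrix.det_mul, ← LinearMap.toMatrix'_comp, hαβ]
      simp
    exact (mul_mem_nonZeroDivisors.mp (h1 ▸ pow_mem hh _)).1
  have hα : Function.Injective α := by
    have := Matrix.mulVec_injective_of_det_mem_nonZeroDivisors hdet
    intro x y hxy
    apply this
    simpa only [LinearMap.toMatrix'_mulVec] using hxy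
  have hinj : Function.Injective φ := fun x y hxy => hα (by simp [α, hxy])
  have hψφ : ∀ w, ψ (φ w) = h • w := fun w => hinj (by rw [hψ, map_smul])
  -- Since `ψφ = h`, dividing `ψ` by `h` in each coordinate gives a left inverse of `φ`.
  let ρ : F →ₗ[T] (ι → A) := (LinearMap.pi fun i => δ ∘ₗ LinearMap.proj i) ∘ₗ ψ.restrictScalars T
  have hρ : ∀ w, ρ (φ w) = w := by
    intro w
    ext i
    simp [ρ, hψφ, hδ]
  -- The complementary projection kills `im φ = ker s`, so it descends to a section of `s`.
  let e : F →ₗ[T] F := LinearMap.id - φ.restrictScalars T ∘ₗ ρ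
  have he : LinearMap.ker (s.restrictScalars T) ≤ LinearMap.ker e := by
    intro x hx
    have : x ∈ LinearMap.ker s := hx
    rw [hφ] at this
    obtain ⟨w, rfl⟩ := this
    simp [e, hρ]
  have hse : ∀ x, s (e x) = s x := by
    intro x
    have : φ (ρ x) ∈ LinearMap.ker s := hφ ▸ LinearMap.mem_range_self φ _
    simp [e, LinearMap.mem_ker.mp this]
  let i : Q →ₗ[T] F := (LinearMap.ker (s.restrictScalars T)).liftQ e he ∘ₗ
    ((s.restrictScalars T).quotKerEquivOfSurjective hs).symm.toLinearMap
  refine Module.Projective.of_split i (s.restrictScalars T) ?_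
  ext q
  obtain ⟨x, rfl⟩ := hs q
  have : ((s.restrictScalars T).quotKerEquivOfSurjective hs).symm (s x) =
      Submodule.Quotient.mk x := by
    rw [LinearEquiv.symm_apply_eq]
    rfl
  simp only [i, LinearMap.comp_apply, LinearEquiv.coe_coe, this]
  exact hse x

/-! ### Maximal minors of a linear pencil -/

namespace HilbertBurch

open Polynomial

variable {A : Type*} [CommRing A] {t : ℕ}

/-- The matrix over `A[X]` obtained from `N` by subtracting `X` on the subdiagonal. -/
noncomputable def pencil (N : Matrix (Fin (t + 1)) (Fin t) A) :
    Matrix (Fin (t + 1)) (Fin t) A[X] :=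
  Matrix.of fun i j => C (N i j) - if i = j.succ then X else 0

/-- The maximal minor of `pencil N` without the `i`-th row. -/
noncomputable def pencilMinor (N : Matrix (Fin (t + 1)) (Fin t) A) (i : Fin (t + 1)) : A[X] :=
  ((pencil N).submatrix i.succAbove id).det

theorem pencil_map {A' : Type*} [CommRing A'] (g : A →+* A')
    (N : Matrix (Fin (t + 1)) (Fin t) A) :
    (pencil N).map (mapRingHom g) = pencil (N.map g) := by
  ext1 i j
  simp only [pencil, Matrix.map_apply, Matrix.of_apply]
  split_ifs <;> simp

theorem map_pencilMinor {A' : Type*} [CommRing A'] (g : A →+* A')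
    (N : Matrix (Fin (t + 1)) (Fin t) A) (i : Fin (t + 1)) :
    mapRingHom g (pencilMinor N i) = pencilMinor (N.map g) i := by
  rw [pencilMinor, pencilMinor, RingHom.map_det, ← pencil_map]
  rfl

theorem pencilMinor_zero (N : Matrix (Fin (t + 1)) (Fin t) A) :
    pencilMinor N 0 = (-1) ^ t * (N.submatrix Fin.succ id).charpoly := by
  have : (pencil N).submatrix (Fin.succAbove 0) id = -(N.submatrix Fin.succ id).charmatrix := by
    ext1 i j
    simp [pencil, Matrix.charmatrix, Matrix.diagonal_apply]
  rw [pencilMinor, this, Matrix.det_neg, Matrix.charpoly, Fintype.card_fin]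

/-- Prepending a copy of column `j` gives a square matrix with two equal columns; its expansion
along the new column is this sum. -/
theorem sum_pencilMinor_mul (N : Matrix (Fin (t + 1)) (Fin t) A) (j : Fin t) :
    ∑ i : Fin (t + 1), (-1) ^ (i : ℕ) * pencil N i j * pencilMinor N i = 0 := by
  have h := Matrix.det_succ_column_zero
    (Matrix.of fun i : Fin (t + 1) => (Fin.cons (pencil N i j) (pencil N i) : Fin (t + 1) → A[X]))
  rw [Matrix.det_zero_of_column_eq (Fin.succ_ne_zero j).symm (by simp)] at h
  rw [h]
  rfl

theorem X_mul_pencilMinor_succ (N : Matrix (Fin (t + 1)) (Fin t) A) (j : Fin t) :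
    X * ((-1) ^ (j.succ : ℕ) * pencilMinor N j.succ) =
      ∑ i : Fin (t + 1), C (N i j) * ((-1) ^ (i : ℕ) * pencilMinor N i) := by
  have h := sum_pencilMinor_mul N j
  have h' : ∀ i : Fin (t + 1), (-1) ^ (i : ℕ) * pencil N i j * pencilMinor N i =
      C (N i j) * ((-1) ^ (i : ℕ) * pencilMinor N i) -
        if i = j.succ then X * ((-1) ^ (i : ℕ) * pencilMinor N i) else 0 := by
    intro i
    rw [pencil, Matrix.of_apply]
    split_ifs <;> ring
  simp only [h', Finset.sum_sub_distrib, Finset.sum_ite_eq', Finset.mem_univ, if_true] at h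
  exact (sub_eq_zero.mp h).symm

/-- The ideal of maximal minors of `pencil N`. -/
noncomputable def pencilIdeal (N : Matrix (Fin (t + 1)) (Fin t) A) : Ideal A[X] :=
  Ideal.span (Set.range (pencilMinor N))

theorem charpoly_mem_pencilIdeal (N : Matrix (Fin (t + 1)) (Fin t) A) :
    (N.submatrix Fin.succ id).charpoly ∈ pencilIdeal N := by
  have h : pencilMinor N 0 ∈ pencilIdeal N := Ideal.subset_span ⟨0, rfl⟩
  have := Ideal.mul_mem_left _ ((-1) ^ t) h
  rwa [pencilMinor_zero, ← mul_assoc, ← mul_pow, neg_one_mul, neg_neg, one_pow, one_mul] at this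

/-- The `A`-linear map to `A[X]` modulo the characteristic polynomial whose components are the
signed maximal minors of `pencil N` other than the first one. -/
noncomputable def minorsMap (N : Matrix (Fin (t + 1)) (Fin t) A) :
    (Fin t → A) →ₗ[A] A[X] ⧸ Ideal.span {(N.submatrix Fin.succ id).charpoly} :=
  Fintype.linearCombination A fun j =>
    Ideal.Quotient.mk _ ((-1) ^ (j.succ : ℕ) * pencilMinor N j.succ)

theorem mk_signed_pencilMinor_mem_range (N : Matrix (Fin (t + 1)) (Fin t) A) (i : Fin (t + 1)) :
    Ideal.Quotient.mk _ ((-1) ^ (i : ℕ) * pencilMinor N i) ∈ LinearMap.range (minorsMap N) := by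
  induction i using Fin.cases with
  | zero =>
    have : Ideal.Quotient.mk (Ideal.span {(N.submatrix Fin.succ id).charpoly})
        ((-1) ^ ((0 : Fin (t + 1)) : ℕ) * pencilMinor N 0) = 0 := by
      rw [Ideal.Quotient.eq_zero_iff_mem, pencilMinor_zero]
      exact Ideal.mul_mem_left _ _ (Ideal.mul_mem_left _ _ (Ideal.mem_span_singleton_self _))
    rw [this]
    exact zero_mem _
  | succ j =>
    refine ⟨Pi.single j 1, ?_⟩
    simp [minorsMap]

theorem mk_X_mul_mem_range (N : Matrix (Fin (t + 1)) (Fin t) A)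
    (x : A[X] ⧸ Ideal.span {(N.submatrix Fin.succ id).charpoly})
    (hx : x ∈ LinearMap.range (minorsMap N)) :
    Ideal.Quotient.mk _ X * x ∈ LinearMap.range (minorsMap N) := by
  obtain ⟨w, rfl⟩ := hx
  simp only [minorsMap, Fintype.linearCombination_apply, Finset.mul_sum, mul_smul_comm, ← map_mul,
    X_mul_pencilMinor_succ]
  refine Submodule.sum_mem _ fun j _ => Submodule.smul_mem _ _ ?_
  rw [map_sum]
  refine Submodule.sum_mem _ fun i _ => ?_
  rw [← smul_eq_C_mul, ← Ideal.Quotient.mkₐ_eq_mk A, map_smul]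
  exact Submodule.smul_mem _ _ (mk_signed_pencilMinor_mem_range N i)

theorem mk_mul_mem_range (N : Matrix (Fin (t + 1)) (Fin t) A) (p : A[X])
    (x : A[X] ⧸ Ideal.span {(N.submatrix Fin.succ id).charpoly})
    (hx : x ∈ LinearMap.range (minorsMap N)) :
    Ideal.Quotient.mk _ p * x ∈ LinearMap.range (minorsMap N) := by
  induction p using Polynomial.induction_on generalizing x with
  | C a =>
    have : Ideal.Quotient.mk (Ideal.span {(N.submatrix Fin.succ id).charpoly}) (C a) * x =
        a • x := (Algebra.smul_def a x).symm
    rw [this]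
    exact Submodule.smul_mem _ _ hx
  | add p q hp hq =>
    rw [map_add, add_mul]
    exact add_mem (hp x hx) (hq x hx)
  | monomial n a ih =>
    rw [pow_succ, ← mul_assoc, map_mul, mul_assoc]
    exact ih _ (mk_X_mul_mem_range N x hx)

/-- The range contains every signed minor and is stable under `A` and `X`, so it is already an
ideal. This presents the quotient by all minors as the cokernel of a square matrix over `A`. -/
theorem mk_mem_range_minorsMap_iff (N : Matrix (Fin (t + 1)) (Fin t) A) (p : A[X]) :
    Ideal.Quotient.mk _ p ∈ LinearMap.range (minorsMap N) ↔ p ∈ pencilIdeal N := by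
  constructor
  · rintro ⟨w, hw⟩
    have : minorsMap N w = Ideal.Quotient.mk _
        (∑ j, C (w j) * ((-1) ^ (j.succ : ℕ) * pencilMinor N j.succ)) := by
      rw [minorsMap, Fintype.linearCombination_apply, map_sum]
      refine Finset.sum_congr rfl fun j _ => ?_
      rw [map_mul _ (C (w j)), Algebra.smul_def]
      rfl
    rw [this, Ideal.Quotient.mk_eq_mk_iff_sub_mem] at hw
    have hle : Ideal.span {(N.submatrix Fin.succ id).charpoly} ≤ pencilIdeal N :=
      (Ideal.span_singleton_le_iff_mem _).mpr (charpoly_mem_pencilIdeal N)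
    refine (Submodule.sub_mem_iff_right _ ?_).mp (hle hw)
    exact Ideal.sum_mem _ fun j _ => Ideal.mul_mem_left _ _ (Ideal.mul_mem_left _ _
      (Ideal.subset_span ⟨_, rfl⟩))
  · intro hp
    induction hp using Submodule.span_induction with
    | mem x hx =>
      obtain ⟨i, rfl⟩ := hx
      have := mk_mul_mem_range N ((-1) ^ (i : ℕ)) _ (mk_signed_pencilMinor_mem_range N i)
      rwa [← map_mul, ← mul_assoc, ← mul_pow, neg_one_mul, neg_neg, one_pow, one_mul] at this
    | zero => rw [map_zero]; exact zero_mem _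
    | add x y _ _ hx hy => rw [map_add]; exact add_mem hx hy
    | smul a x _ hx => rw [smul_eq_mul, map_mul]; exact mk_mul_mem_range N a _ hx

end HilbertBurch

/-! ### Finiteness and flatness when the ideal contains a monic polynomial in `y` -/

namespace HilbertBurch

open Polynomial

section Relative

variable {T : Type*} [CommRing T] {t : ℕ}

/-- Division by a monic polynomial as a linear map. -/
noncomputable def divByMonicLinearMap {h : T[X]} (hh : h.Monic) : T[X] →ₗ[T] T[X] where
  toFun a := a /ₘ h
  map_add' a b := hh.isRegular.left (by
    have := modByMonic_add_div (a + b) h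
    have ha := modByMonic_add_div a h
    have hb := modByMonic_add_div b h
    rw [add_modByMonic] at this
    linear_combination this - ha - hb)
  map_smul' c a := hh.isRegular.left (by
    have := modByMonic_add_div (c • a) h
    have ha := modByMonic_add_div a h
    rw [smul_modByMonic] at this
    simp only [smul_eq_C_mul, RingHom.id_apply] at this ⊢
    linear_combination this - C c * ha)

theorem projective_quotient_pencilIdeal (N : Matrix (Fin (t + 1)) (Fin t) T[X]) (h : T[X])
    (hh : h.Monic) (hN : C h ∈ pencilIdeal N) :
    Module.Projective T (T[X][X] ⧸ pencilIdeal N) := by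
  -- The characteristic polynomial is sure to have degree `t` only over a nontrivial ring.
  nontriviality T
  have hf := (N.submatrix Fin.succ id).charpoly_monic
  have hle : Ideal.span {(N.submatrix Fin.succ id).charpoly} ≤ pencilIdeal N :=
    (Ideal.span_singleton_le_iff_mem _).mpr (charpoly_mem_pencilIdeal N)
  have := hf.free_quotient
  have : Module.Projective T (T[X][X] ⧸ Ideal.span {(N.submatrix Fin.succ id).charpoly}) :=
    have : Module.Free T (T[X][X] ⧸ Ideal.span {(N.submatrix Fin.succ id).charpoly}) :=
      Module.Free.trans (S := T[X])
    inferInstance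
  have hdeg : (AdjoinRoot.powerBasis' hf).dim = t := by
    rw [AdjoinRoot.powerBasis'_dim, Matrix.charpoly_natDegree_eq_dim, Fintype.card_fin]
  let b : Module.Basis (Fin t) T[X]
      (T[X][X] ⧸ Ideal.span {(N.submatrix Fin.succ id).charpoly}) :=
    (AdjoinRoot.powerBasis' hf).basis.reindex (finCongr hdeg)
  refine projective_of_smul_mem_range b (minorsMap N)
    (Ideal.Quotient.factorₐ T[X] hle).toLinearMap (Ideal.Quotient.factor_surjective hle) ?_ h
    hh.mem_nonZeroDivisors ?_ (divByMonicLinearMap hh) (fun a => mul_divByMonic_cancel_left a hh)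
  · ext x
    obtain ⟨p, rfl⟩ := Ideal.Quotient.mk_surjective x
    rw [mk_mem_range_minorsMap_iff, ← Ideal.Quotient.eq_zero_iff_mem]
    rfl
  · intro x
    obtain ⟨p, rfl⟩ := Ideal.Quotient.mk_surjective x
    have : h • Ideal.Quotient.mk (Ideal.span {(N.submatrix Fin.succ id).charpoly}) p =
        Ideal.Quotient.mk _ (p * C h) := by
      rw [Algebra.smul_def, mul_comm p, map_mul]
      rfl
    rw [this, mk_mem_range_minorsMap_iff]
    exact Ideal.mul_mem_left _ _ hN

/-- The structure map of the quotient of `T[X][X]` by an ideal. -/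
noncomputable def structureMap {T : Type*} [CommRing T] (I : Ideal T[X][X]) :
    T →+* T[X][X] ⧸ I :=
  (Ideal.Quotient.mk I).comp ((C : T[X] →+* T[X][X]).comp C)

theorem flat_structureMap (N : Matrix (Fin (t + 1)) (Fin t) T[X]) (h : T[X])
    (hh : h.Monic) (hN : C h ∈ pencilIdeal N) : (structureMap (pencilIdeal N)).Flat := by
  have := projective_quotient_pencilIdeal N h hh hN
  exact RingHom.flat_algebraMap_iff.mpr (inferInstanceAs (Module.Flat T (T[X][X] ⧸ pencilIdeal N)))

/-- The monic characteristic polynomial makes the quotient finite over `T[y]`; this action factors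
through `T[y]/(h)`, which is finite over `T`. -/
theorem finite_structureMap (N : Matrix (Fin (t + 1)) (Fin t) T[X]) (h : T[X])
    (hh : h.Monic) (hN : C h ∈ pencilIdeal N) : (structureMap (pencilIdeal N)).Finite := by
  have hf := (N.submatrix Fin.succ id).charpoly_monic
  have hle : Ideal.span {(N.submatrix Fin.succ id).charpoly} ≤ pencilIdeal N :=
    (Ideal.span_singleton_le_iff_mem _).mpr (charpoly_mem_pencilIdeal N)
  have hA : ((Ideal.Quotient.mk (pencilIdeal N)).comp (C : T[X] →+* T[X][X])).Finite := by
    have h1 : (algebraMap T[X]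
        (T[X][X] ⧸ Ideal.span {(N.submatrix Fin.succ id).charpoly})).Finite :=
      RingHom.finite_algebraMap.mpr hf.finite_quotient
    exact (RingHom.Finite.of_surjective _ (Ideal.Quotient.factor_surjective hle)).comp h1
  have hker : ∀ a ∈ Ideal.span {h},
      ((Ideal.Quotient.mk (pencilIdeal N)).comp (C : T[X] →+* T[X][X])) a = 0 := by
    intro a ha
    obtain ⟨c, rfl⟩ := Ideal.mem_span_singleton.mp ha
    rw [RingHom.comp_apply, Ideal.Quotient.eq_zero_iff_mem, map_mul]
    exact Ideal.mul_mem_right _ _ hN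
  have hlift : (Ideal.Quotient.lift (Ideal.span {h}) _ hker).Finite := by
    refine RingHom.Finite.of_comp_finite (f := Ideal.Quotient.mk (Ideal.span {h})) ?_
    rwa [Ideal.Quotient.lift_comp_mk]
  have hT : (algebraMap T (T[X] ⧸ Ideal.span {h})).Finite :=
    RingHom.finite_algebraMap.mpr hh.finite_quotient
  exact hlift.comp hT

end Relative

/-! ### Base change of the family -/

section BaseChange

variable {R T : Type u} [CommRing R] [CommRing T]

/-- Quotients of bivariate polynomial rings are compatible with base change. -/
theorem isPushout_structureMap (g : R →+* T) (I : Ideal R[X][X]) (J : Ideal T[X][X])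
    (hJ : J = I.map (mapRingHom (mapRingHom g))) :
    ∃ v : R[X][X] ⧸ I →+* T[X][X] ⧸ J,
      IsPushout (CommRingCat.ofHom (structureMap I)) (CommRingCat.ofHom g)
        (CommRingCat.ofHom v) (CommRingCat.ofHom (structureMap J)) := by
  let v : R[X][X] ⧸ I →+* T[X][X] ⧸ J := Ideal.quotientMap J (mapRingHom (mapRingHom g))
    (hJ ▸ Ideal.le_comap_map)
  have hv : ∀ p, v (Ideal.Quotient.mk I p) =
      Ideal.Quotient.mk J (mapRingHom (mapRingHom g) p) := fun p => Ideal.quotientMap_mk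
  have key : ∀ s : PushoutCocone (CommRingCat.ofHom (structureMap I)) (CommRingCat.ofHom g),
      ∃ d : T[X][X] ⧸ J →+* s.pt, d.comp v = s.inl.hom ∧
        d.comp (structureMap J) = s.inr.hom := by
    intro s
    -- Scalars go through the second leg of the cocone, the two variables through the first.
    let w : T[X][X] →+* s.pt := eval₂RingHom (eval₂RingHom s.inr.hom
      (s.inl.hom (Ideal.Quotient.mk I (C X)))) (s.inl.hom (Ideal.Quotient.mk I X))
    have hw : w.comp (mapRingHom (mapRingHom g)) = s.inl.hom.comp (Ideal.Quotient.mk I) := by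
      ext r
      · have := congr($(s.condition).hom r)
        simpa [w, structureMap] using this.symm
      · simp [w]
      · simp [w]
    have hle : ∀ a ∈ J, w a = 0 := by
      change J ≤ RingHom.ker w
      rw [hJ, Ideal.map_le_iff_le_comap]
      intro x hx
      have := congr($hw x)
      rw [RingHom.comp_apply, RingHom.comp_apply, Ideal.Quotient.eq_zero_iff_mem.mpr hx,
        map_zero] at this
      exact this
    refine ⟨Ideal.Quotient.lift J w hle, ?_, ?_⟩
    · refine Ideal.Quotient.ringHom_ext (RingHom.ext fun p => ?_)
      rw [RingHom.comp_apply, RingHom.comp_apply, hv, Ideal.Quotient.lift_mk]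
      exact congr($hw p)
    · refine RingHom.ext fun r => ?_
      have : Ideal.Quotient.lift J w hle (Ideal.Quotient.mk J (C (C r))) = w (C (C r)) :=
        Ideal.Quotient.lift_mk J w hle
      exact this.trans (by simp [w])
  choose d hd₁ hd₂ using key
  refine ⟨v, ⟨⟨?_⟩, ⟨PushoutCocone.IsColimit.mk _ (fun s => CommRingCat.ofHom (d s))
    ?_ ?_ ?_⟩⟩⟩
  · ext r
    simp [structureMap, hv]
  · exact fun s => CommRingCat.hom_ext (hd₁ s)
  · exact fun s => CommRingCat.hom_ext (hd₂ s)
  · intro s e h₁ h₂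
    have h₁' : e.hom.comp v = (d s).comp v := by
      rw [hd₁, ← h₁]
      rfl
    have h₂' : e.hom.comp (structureMap J) = (d s).comp (structureMap J) := by
      rw [hd₂, ← h₂]
      rfl
    refine CommRingCat.hom_ext (Ideal.Quotient.ringHom_ext ?_)
    refine Polynomial.ringHom_ext' (Polynomial.ringHom_ext' h₂' ?_) ?_
    · simpa [hv] using congr($h₁' (Ideal.Quotient.mk I (C X)))
    · simpa [hv] using congr($h₁' (Ideal.Quotient.mk I X))

end BaseChange

end HilbertBurch

/-! ### The universal family and its restriction to the stratum -/

namespace HilbertBurch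

open Polynomial

section Universal

variable (k : Type u) [Field k] {t : ℕ} (m : Fin (t + 1) → ℕ)

/-- The matrix over `k[a][y]` whose pencil in `x` is the spread out matrix. -/
noncomputable def constantMatrix : Matrix (Fin (t + 1)) (Fin t) (ParamRing k m)[X] :=
  Matrix.of fun i j => (if i = j.castSucc then X ^ step m j else 0) +
    ∑ l : Fin (bound m i j), C (MvPolynomial.X (⟨i, j, l⟩ : Param m)) * X ^ (l : ℕ)

theorem spreadMatrix_eq_pencil : spreadMatrix k m = pencil (constantMatrix k m) := by
  ext1 i j
  have hne : j.castSucc ≠ j.succ := (Fin.castSucc_lt_succ).ne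
  simp only [spreadMatrix, monomialMatrix, pencil, constantMatrix, Matrix.add_apply,
    Matrix.of_apply, entry, map_add, map_sum, map_mul, map_pow, yVar, xVar]
  by_cases h : i = j.castSucc
  · subst h
    simp [hne]
  · by_cases h' : i = j.succ
    · subst h'
      simp [hne.symm]
      ring
    · simp [h, h']

theorem minor_eq_pencilMinor : minor k m = pencilMinor (constantMatrix k m) := by
  funext i
  rw [minor, spreadMatrix_eq_pencil, pencilMinor]

theorem minorIdeal_eq_pencilIdeal : minorIdeal k m = pencilIdeal (constantMatrix k m) := by
  rw [minorIdeal, minor_eq_pencilMinor, pencilIdeal]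

theorem natDegree_minor_zero : (minor k m 0).natDegree = t := by
  rw [minor_eq_pencilMinor, pencilMinor_zero]
  rcases neg_one_pow_eq_or (TotalRing k m) t with ht | ht <;> rw [ht] <;> simp

theorem C_res_mem_minorIdeal : C (res k m) ∈ minorIdeal k m := by
  have hmem : ∀ i, minor k m i ∈ minorIdeal k m := fun i => Ideal.subset_span ⟨i, rfl⟩
  -- The Bézout identity for resultants needs a positive degree; for `t = 0` the empty minor is `1`.
  rcases Nat.eq_zero_or_pos t with rfl | ht
  · have h1 : minor k m 0 = 1 := by simp [minor]
    have htop : minorIdeal k m = ⊤ := (Ideal.eq_top_iff_one _).mpr (h1 ▸ hmem 0)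
    rw [htop]
    trivial
  · obtain ⟨p, q, -, -, h⟩ := exists_mul_add_mul_eq_C_resultant (minor k m 0)
      (minor k m (Fin.last t)) le_rfl le_rfl (.inl (by rw [natDegree_minor_zero]; exact ht.ne'))
    rw [res, ← h]
    exact add_mem (Ideal.mul_mem_right _ _ (hmem _)) (Ideal.mul_mem_right _ _ (hmem _))

/-- The ring homomorphism underlying the inclusion of the stratum. -/
noncomputable def toStratumRing : ParamRing k m →+* StratumRing k m :=
  (algebraMap (ParamRing k m ⧸ higherCoeffIdeal k m) (StratumRing k m)).comp
    (Ideal.Quotient.mk (higherCoeffIdeal k m))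

theorem isUnit_toStratumRing_coeff :
    IsUnit (toStratumRing k m ((res k m).coeff (expectedDegree m))) :=
  IsLocalization.Away.algebraMap_isUnit
    (Ideal.Quotient.mk (higherCoeffIdeal k m) ((res k m).coeff (expectedDegree m)))

theorem toStratumRing_coeff_eq_zero {n : ℕ} (hn : expectedDegree m < n) :
    toStratumRing k m ((res k m).coeff n) = 0 := by
  have h : Ideal.Quotient.mk (higherCoeffIdeal k m) ((res k m).coeff n) = 0 :=
    Ideal.Quotient.eq_zero_iff_mem.mpr (Ideal.subset_span ⟨n, hn, rfl⟩)
  exact (congrArg (algebraMap _ (StratumRing k m)) h).trans (map_zero _)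

/-- The matrix `constantMatrix` restricted to the stratum. -/
noncomputable def stratumMatrix : Matrix (Fin (t + 1)) (Fin t) (StratumRing k m)[X] :=
  (constantMatrix k m).map (mapRingHom (toStratumRing k m))

theorem pencilIdeal_stratumMatrix : pencilIdeal (stratumMatrix k m) =
    (minorIdeal k m).map (mapRingHom (mapRingHom (toStratumRing k m))) := by
  rw [minorIdeal_eq_pencilIdeal, pencilIdeal, pencilIdeal, Ideal.map_span, ← Set.range_comp]
  congr 2
  funext i
  exact (map_pencilMinor _ _ i).symm

/-- On the stratum the resultant has invertible leading coefficient, so it can be rescaled to a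
monic polynomial. -/
theorem exists_monic_mem_pencilIdeal :
    ∃ h : (StratumRing k m)[X], h.Monic ∧ C h ∈ pencilIdeal (stratumMatrix k m) := by
  obtain ⟨u, hu⟩ := isUnit_toStratumRing_coeff k m
  refine ⟨C (↑u⁻¹ : StratumRing k m) * (res k m).map (toStratumRing k m), ?_, ?_⟩
  · refine monic_of_natDegree_le_of_coeff_eq_one (expectedDegree m) ?_ ?_
    · rw [natDegree_le_iff_coeff_eq_zero]
      intro n hn
      rw [coeff_C_mul, coeff_map, toStratumRing_coeff_eq_zero k m hn, mul_zero]
    · rw [coeff_C_mul, coeff_map, ← hu, Units.inv_mul]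
  · rw [map_mul, pencilIdeal_stratumMatrix]
    refine Ideal.mul_mem_left _ _ ?_
    simpa using Ideal.mem_map_of_mem (mapRingHom (mapRingHom (toStratumRing k m)))
      (C_res_mem_minorIdeal k m)

theorem familyOnStratum_eq : ∃ e : pullback (family k m) (stratumToBase k m) ≅
      Spec (CommRingCat.of ((StratumRing k m)[X][X] ⧸ pencilIdeal (stratumMatrix k m))),
    familyOnStratum k m =
      e.hom ≫ Spec.map (CommRingCat.ofHom (structureMap (pencilIdeal (stratumMatrix k m)))) := by
  obtain ⟨v, hv⟩ := isPushout_structureMap (toStratumRing k m) (minorIdeal k m) _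
    (pencilIdeal_stratumMatrix k m)
  have h := isPullback_SpecMap_of_isPushout _ _ _ _ hv
  have hf : family k m = Spec.map (CommRingCat.ofHom (structureMap (minorIdeal k m))) := by
    rw [family, incidenceToPlane, planeToBase, ← Spec.map_comp]
    rfl
  have h' : IsPullback (Spec.map (CommRingCat.ofHom v))
      (Spec.map (CommRingCat.ofHom (structureMap (pencilIdeal (stratumMatrix k m)))))
      (family k m) (stratumToBase k m) := by
    rw [hf]
    exact h
  exact ⟨h'.isoPullback.symm, h'.isoPullback_inv_snd.symm⟩

instance isImmersion_stratumToBase : IsImmersion (stratumToBase k m) := by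
  have h : stratumToBase k m =
      Spec.map (CommRingCat.ofHom
        (algebraMap (ParamRing k m ⧸ higherCoeffIdeal k m) (StratumRing k m))) ≫
      Spec.map (CommRingCat.ofHom (Ideal.Quotient.mk (higherCoeffIdeal k m))) := by
    rw [← Spec.map_comp]
    rfl
  have : IsOpenImmersion (Spec.map (CommRingCat.ofHom
      (algebraMap (ParamRing k m ⧸ higherCoeffIdeal k m) (StratumRing k m)))) :=
    IsOpenImmersion.of_isLocalization
      (Ideal.Quotient.mk (higherCoeffIdeal k m) ((res k m).coeff (expectedDegree m)))
  have : IsClosedImmersion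
      (Spec.map (CommRingCat.ofHom (Ideal.Quotient.mk (higherCoeffIdeal k m)))) :=
    IsClosedImmersion.spec_of_surjective _ Ideal.Quotient.mk_surjective
  rw [h]
  infer_instance

/-- The coefficient of `y ^ (t * m_t)` is a unit on the stratum, so it lies in no prime there. -/
theorem range_stratumToBase_subset :
    Set.range (stratumToBase k m) ⊆ Set.range (baseOpen k m).ι := by
  rintro _ ⟨x, rfl⟩
  rw [Scheme.Opens.range_ι]
  intro hx
  have hc : (res k m).coeff (expectedDegree m) ∈ (stratumToBase k m x).asIdeal :=
    hx ⟨_, rfl⟩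
  exact x.isPrime.ne_top (Ideal.eq_top_of_isUnit_mem _ hc (isUnit_toStratumRing_coeff k m))

end Universal

end HilbertBurch

theorem corollary6p3 (k : Type u) [Field k] (t : ℕ) (m : Fin (t + 1) → ℕ)
    (hm0 : m 0 = 0) (hm : Monotone m) :
    (∃ j : HilbertBurch.stratum k m ⟶ (HilbertBurch.baseOpen k m).toScheme,
      IsImmersion j ∧ j ≫ (HilbertBurch.baseOpen k m).ι = HilbertBurch.stratumToBase k m) ∧
    IsFinite (HilbertBurch.familyOnStratum k m) ∧
    Flat (HilbertBurch.familyOnStratum k m) := by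
  refine ⟨⟨IsOpenImmersion.lift (HilbertBurch.baseOpen k m).ι (HilbertBurch.stratumToBase k m)
    (HilbertBurch.range_stratumToBase_subset k m), ?_, IsOpenImmersion.lift_fac _ _ _⟩, ?_⟩
  · refine @IsImmersion.of_comp _ _ _ _ (HilbertBurch.baseOpen k m).ι ?_
    rw [IsOpenImmersion.lift_fac]
    infer_instance
  · obtain ⟨e, he⟩ := HilbertBurch.familyOnStratum_eq k m
    obtain ⟨h, hh, hN⟩ := HilbertBurch.exists_monic_mem_pencilIdeal k m
    let f := CommRingCat.ofHom (HilbertBurch.structureMap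
      (HilbertBurch.pencilIdeal (HilbertBurch.stratumMatrix k m)))
    have : IsFinite (Spec.map f) :=
      (IsFinite.SpecMap_iff f).mpr (HilbertBurch.finite_structureMap _ h hh hN)
    have : Flat (Spec.map f) :=
      Flat.SpecMap_iff.mpr (HilbertBurch.flat_structureMap _ h hh hN)
    rw [he]
    exact ⟨inferInstance, inferInstance⟩
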